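/- **Theorem (finite-dimensional approximation).** For $\alpha\in\mathbb R$ let $\mathbb E_\alpha$ be the Banach space of complex sequences $u=(u_n)_{n\ge 0}$ with $\|u\|_\alpha:=\sum_{n=0}^\infty |u_n|e^{\alpha n}<\infty$. Let $(a_{nk})_{n,k\ge 0}$ be a complex matrix and suppose: - (E1) $a_{nk}=-\delta_{nk}d_n+b_{nk}+c_{nk}$ for all $n,k\ge 0$, with $d_n\in(0,\infty)$ and $b_{nk},c_{nk}\in\mathbb C$. - (E2) There is $\alpha_*\in\mathbb R$ and, for every $\alpha>\alpha_*$, a constant $q(\alpha)\in(0,1)$ with $e^{-\alpha k}\sum_{n=0}^\infty|b_{nk}|e^{\alpha n}\le q(\alpha)d_k$ for all $k\ge 0$. - (E3) $\sup_n d_ne^{-\nu n}<\infty$ for all $\nu>0$. - (E4) There is a continuous non-decreasing function $M:(\alpha_*,\infty)\to(0,\infty)$ with $e^{-\alpha k}\sum_{n=0}^\infty|c_{nk}|e^{\alpha' n}\le \frac{M(\alpha)}{\alpha-\alpha'}$ for all $k\ge 0$ and all $\alpha_*<\alpha'<\alpha$. For $N\ge1$ put $a^N_{nk}=-\delta_{nk}d^N_n+b^N_{nk}+c^N_{nk}$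 with $d_n^N=\mathbf 1_{\{n\le N\}}d_n$, $b^N_{nk}=\mathbf 1_{\{n,k\le N\}}b_{nk}$, $c^N_{nk}=\mathbf 1_{\{n,k\le N\}}c_{nk}$. Fix $\alpha_*<\alpha'<\alpha$ and $x\in\mathbb E_\alpha$, and set $T(\alpha',\alpha)=\frac{\alpha-\alpha'}{2eM(\alpha)}$. A *classical solution in $\mathbb E_{\alpha'}$ on $[0,T(\alpha',\alpha))$* of $$\frac{du_n(t)}{dt}=\sum_{k=0}^\infty a_{nk}u_k(t),\qquad u_n(0)=x_n,\qquad n\ge 0,$$ is a function $u\in C([0,T(\alpha',\alpha));\mathbb E_{\alpha'})$ with $u(0)=x$ such that, for every $\alpha''\in(\alpha_*,\alpha')$, $u\in C^1([0,T(\alpha',\alpha));\mathbb E_{\alpha''})$ and its derivative in $\mathbb E_{\alpha''}$ at each time $t$ is the sequence $\bigl(\sum_k a_{nk}u_k(t)\bigr)_{n\ge 0}$, all these series being convergent. Classical solutions for $(a^N_{nk})$ are defined in the same way, with the same initial value $x$. Then the system with matrix $(a_{nk})$ has a unique classical solution $u$ in $\mathbb E_{\alpha'}$ on $[0,T(\alpha',\alpha))$;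 for every $N\ge1$ the system with matrix $(a_{nk}^N)$ has a unique classical solution $u^N$ in $\mathbb E_{\alpha'}$ on $[0,T(\alpha',\alpha))$; and $$\lim_{N\to\infty}\ \sup_{t\in[0,T]}\ \sum_{n=0}^\infty|u^N_n(t)-u_n(t)|e^{\alpha' n}=0\qquad\text{for every }T\in(0,T(\alpha',\alpha)).$$ -/

import Mathlib

open Filter Topology Set

noncomputable section

namespace InfODE

/-- The complex sequences `u` with `∑ₙ |uₙ| e^{α n} < ∞`, as a linear subspace of all sequences. -/
def seqSubmodule (α : ℝ) : Submodule ℂ (ℕ → ℂ) where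
  carrier := {u | Summable fun n : ℕ => ‖u n‖ * Real.exp (α * n)}
  add_mem' := by
    intro u v hu hv
    refine Summable.of_nonneg_of_le (fun n => by positivity) (fun n => ?_) (hu.add hv)
    rw [← add_mul]
    exact mul_le_mul_of_nonneg_right (norm_add_le _ _) (Real.exp_pos _).le
  zero_mem' := by simp
  smul_mem' := by
    intro z u hu
    have h := Summable.mul_left ‖z‖ hu
    simpa [mul_assoc] using h

/-- The Banach space `E_α`. It is a type of its own, so that its topology is the one of the norm
below and not the topology of componentwise convergence. -/
def E (α : ℝ) : Type := seqSubmodule α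

instance (α : ℝ) : AddCommGroup (E α) := inferInstanceAs (AddCommGroup (seqSubmodule α))

instance (α : ℝ) : Module ℂ (E α) := inferInstanceAs (Module ℂ (seqSubmodule α))

/-- An element of `E_α` as a sequence. -/
def E.seq {α : ℝ} (u : E α) : ℕ → ℂ := Subtype.val u

/-- A sequence with finite norm as an element of `E_α`. -/
def E.mk {α : ℝ} (u : ℕ → ℂ) (hu : Summable fun n : ℕ => ‖u n‖ * Real.exp (α * n)) : E α :=
  ⟨u, hu⟩

theorem E.summable {α : ℝ} (u : E α) : Summable fun n : ℕ => ‖u.seq n‖ * Real.exp (α * n) :=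
  Subtype.property u

theorem E.ext_seq {α : ℝ} {u v : E α} (h : ∀ n, u.seq n = v.seq n) : u = v :=
  Subtype.ext (funext h)

/-- The norm `‖u‖_α = ∑ₙ |uₙ| e^{α n}`. -/
instance (α : ℝ) : Norm (E α) := ⟨fun u => ∑' n : ℕ, ‖u.seq n‖ * Real.exp (α * n)⟩

theorem E.norm_def {α : ℝ} (u : E α) : ‖u‖ = ∑' n : ℕ, ‖u.seq n‖ * Real.exp (α * n) := rfl

theorem E.core (α : ℝ) : NormedSpace.Core ℂ (E α) where
  norm_nonneg u := tsum_nonneg fun n => by positivity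
  norm_smul z u := by
    rw [E.norm_def, E.norm_def, ← tsum_mul_left]
    refine tsum_congr fun n => ?_
    rw [← mul_assoc, ← norm_mul]
    rfl
  norm_triangle u v := by
    rw [E.norm_def, E.norm_def, E.norm_def, ← u.summable.tsum_add v.summable]
    refine (u + v).summable.tsum_le_tsum (fun n => ?_) (u.summable.add v.summable)
    rw [← add_mul]
    exact mul_le_mul_of_nonneg_right (norm_add_le _ _) (Real.exp_pos _).le
  norm_eq_zero_iff u := by
    constructor
    · intro h
      have hs := u.summable.hasSum
      rw [← E.norm_def, h] at hs
      have h0 := (hasSum_zero_iff_of_nonneg (fun n : ℕ =>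
        mul_nonneg (norm_nonneg (u.seq n)) (Real.exp_pos (α * n)).le)).1 hs
      refine E.ext_seq fun n => ?_
      have hn := congrFun h0 n
      have hz : (0 : E α).seq n = 0 := rfl
      rw [hz]
      simpa [Real.exp_ne_zero] using hn
    · rintro rfl
      rw [E.norm_def]
      have : ∀ n : ℕ, (0 : E α).seq n = 0 := fun n => rfl
      simp [this]

instance (α : ℝ) : NormedAddCommGroup (E α) := NormedAddCommGroup.ofCore (E.core α)

instance (α : ℝ) : NormedSpace ℂ (E α) := NormedSpace.ofCore (E.core α)

instance (α : ℝ) : NormedSpace ℝ (E α) := NormedSpace.restrictScalars ℝ ℂ (E α)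

/-- The embedding `E_α ⊂ E_β` for `β ≤ α`. -/
def E.incl {α β : ℝ} (h : β ≤ α) (u : E α) : E β :=
  E.mk u.seq (Summable.of_nonneg_of_le (fun n => by positivity)
    (fun n => mul_le_mul_of_nonneg_left
      (Real.exp_le_exp.2 (mul_le_mul_of_nonneg_right h (Nat.cast_nonneg n))) (norm_nonneg _))
    u.summable)

/-- The matrix `-δ_{nk} d_n + b_{nk} + c_{nk}`. -/
def coeff (d : ℕ → ℝ) (b c : ℕ → ℕ → ℂ) (n k : ℕ) : ℂ :=
  -(if n = k then (d n : ℂ) else 0) + b n k + c n k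

/-- `1_{n ≤ N} d_n`. -/
def truncSeq (N : ℕ) (d : ℕ → ℝ) (n : ℕ) : ℝ := if n ≤ N then d n else 0

/-- `1_{n, k ≤ N} b_{nk}`. -/
def truncMat (N : ℕ) (b : ℕ → ℕ → ℂ) (n k : ℕ) : ℂ := if n ≤ N ∧ k ≤ N then b n k else 0

/-- The standing assumptions on the coefficients, for the indices `α > αs`. Each bound on an
infinite sum of nonnegative terms includes its convergence. -/
structure Conditions (αs : ℝ) (M : ℝ → ℝ) (a : ℕ → ℕ → ℂ) (d : ℕ → ℝ) (b c : ℕ → ℕ → ℂ) :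
    Prop where
  decomposition : ∀ n k, a n k = coeff d b c n k
  d_pos : ∀ n, 0 < d n
  b_bound : ∀ α, αs < α → ∃ q ∈ Ioo (0 : ℝ) 1, ∀ k : ℕ,
    (Summable fun n : ℕ => ‖b n k‖ * Real.exp (α * n)) ∧
      Real.exp (-α * k) * ∑' n : ℕ, ‖b n k‖ * Real.exp (α * n) ≤ q * d k
  d_growth : ∀ ν : ℝ, 0 < ν → BddAbove (range fun n : ℕ => d n * Real.exp (-ν * n))
  M_pos : ∀ α, αs < α → 0 < M α
  M_continuous : ContinuousOn M (Ioi αs)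
  M_increasing : MonotoneOn M (Ioi αs)
  c_bound : ∀ α' α, αs < α' → α' < α → ∀ k : ℕ,
    (Summable fun n : ℕ => ‖c n k‖ * Real.exp (α' * n)) ∧
      Real.exp (-α * k) * ∑' n : ℕ, ‖c n k‖ * Real.exp (α' * n) ≤ M α / (α - α')

/-- A classical solution in `E_{α'}` on `[0, T)` of the system `u_n' = ∑ₖ a_{nk} u_k`, `u_n(0) = x_n`:
`u` is continuous with values in `E_{α'}` and, for every `α'' ∈ (αs, α')`, continuously
differentiable with values in `E_{α''}`, where its derivative `w(t)` is the sequence with the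
components `∑ₖ a_{nk} u_k(t)`; the convergence of these series is part of the definition.
The values of `u` outside `[0, T)` are irrelevant. -/
structure IsClassicalSolution (αs α' : ℝ) (T : ℝ) (a : ℕ → ℕ → ℂ) (x : ℕ → ℂ) (u : ℝ → E α') :
    Prop where
  initial : ∀ n, (u 0).seq n = x n
  continuousOn : ContinuousOn u (Ico 0 T)
  equation : ∀ α'', αs < α'' → ∀ h : α'' < α', ∃ w : ℝ → E α'',
    ContinuousOn w (Ico 0 T) ∧
    ∀ t ∈ Ico 0 T,
      HasDerivWithinAt (fun s => E.incl h.le (u s)) (w t) (Ico 0 T) t ∧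
      ∀ n, HasSum (fun k => a n k * (u t).seq k) ((w t).seq n)

/-- `u` is the unique classical solution in `E_{α'}` on `[0, T)`. -/
def IsUniqueClassicalSolution (αs α' : ℝ) (T : ℝ) (a : ℕ → ℕ → ℂ) (x : ℕ → ℂ) (u : ℝ → E α') :
    Prop :=
  IsClassicalSolution αs α' T a x u ∧
    ∀ v : ℝ → E α', IsClassicalSolution αs α' T a x v → EqOn v u (Ico 0 T)

/-- The life time `T(α', α) = (α - α') / (2 e M(α))`. -/
def lifeTime (M : ℝ → ℝ) (α' α : ℝ) : ℝ := (α - α') / (2 * Real.exp 1 * M α)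

end InfODE

end

/-! The proof is an a priori estimate in a norm whose exponent decreases in time. Put `lam = e
M(α)`. Applying (E4) with the gap `1/k` bounds the `k`-th column of `c` in the weight `e^{βn}` by
`(lam k + K) e^{βk}`, and (E2) bounds that of `b` by `d_k e^{βk}`; together this is `ColBound`. If
`β(t)` decreases at speed `lam`, differentiating `e^{β(t)k}` produces the damping `-lam k`, the
diagonal gives `-d_k`, and the two cancel the column bound up to `K`. Hence `∑ |u_n| e^{β(t)n}`
obeys a Gronwall inequality (`ColBound.sum_le_gronwallBound`). Over the life time the exponent falls
by `lam T = (α - α')/2`; the other half of the gap is spent on fixed losses.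

By (E3) the matrix is bounded from `E_{β+ν}` to `E_β` for every `ν > 0`, and truncation at `N`
removes an operator of norm `O(e^{-εN})` at a loss of `3ε` in the exponent
(`ColBound.exists_matBound_tail`). Feeding this error into the estimate for finite systems gives
both halves of the theorem. The difference of two solutions solves the first `N + 1` equations up to
such an error, so it vanishes. The truncated solutions, exponentials of bounded operators, form a
Cauchy sequence, and their limit solves the full system. -/

noncomputable section

namespace InfODE

/-! ### The spaces `E_α`: coordinates, embeddings, completeness. -/

namespace E

variable {α β γ : ℝ}

@[simp] theorem seq_mk (u : ℕ → ℂ) (hu : Summable fun n : ℕ => ‖u n‖ * Real.exp (α * n)) (n : ℕ) :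
    (E.mk u hu).seq n = u n := (rfl)

@[simp] theorem seq_zero (n : ℕ) : (0 : E α).seq n = 0 := rfl

@[simp] theorem seq_add (u v : E α) (n : ℕ) : (u + v).seq n = u.seq n + v.seq n := rfl

@[simp] theorem seq_sub (u v : E α) (n : ℕ) : (u - v).seq n = u.seq n - v.seq n := by
  rw [eq_sub_iff_add_eq, ← seq_add, sub_add_cancel]

@[simp] theorem seq_smul (z : ℂ) (u : E α) (n : ℕ) : (z • u).seq n = z * u.seq n := by
  have h : (z • u).seq = z • u.seq := rfl
  rw [h, Pi.smul_apply, smul_eq_mul]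

@[simp] theorem seq_incl (h : β ≤ α) (u : E α) (n : ℕ) : (E.incl h u).seq n = u.seq n :=
  seq_mk _ _ n

theorem incl_incl (h : β ≤ α) (h' : γ ≤ β) (u : E α) :
    E.incl h' (E.incl h u) = E.incl (h'.trans h) u :=
  ext_seq fun n => by simp only [seq_incl]

theorem sum_le_norm (u : E α) (s : Finset ℕ) :
    ∑ n ∈ s, ‖u.seq n‖ * Real.exp (α * n) ≤ ‖u‖ :=
  u.summable.sum_le_tsum s fun n _ => by positivity

theorem norm_le_of_sum_le (u : E α) {C : ℝ}
    (h : ∀ N, ∑ n ∈ Finset.range N, ‖u.seq n‖ * Real.exp (α * n) ≤ C) : ‖u‖ ≤ C :=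
  Real.tsum_le_of_sum_range_le (fun n => by positivity) h

theorem norm_incl_le (h : β ≤ α) (u : E α) : ‖E.incl h u‖ ≤ ‖u‖ := by
  rw [norm_def, norm_def]
  refine (E.incl h u).summable.tsum_le_tsum (fun n => ?_) u.summable
  rw [seq_incl]
  gcongr

/-- The embedding `E_α ⊂ E_β` as a continuous linear map. -/
def inclL (h : β ≤ α) : E α →L[ℂ] E β :=
  LinearMap.mkContinuous ⟨⟨E.incl h, fun _ _ => rfl⟩, fun _ _ => rfl⟩ 1 fun u => by
    rw [one_mul]
    exact norm_incl_le h u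

theorem norm_seq_le (u : E α) (n : ℕ) : ‖u.seq n‖ ≤ Real.exp (-(α * n)) * ‖u‖ := by
  have h := sum_le_norm u {n}
  rw [Finset.sum_singleton] at h
  rw [Real.exp_neg, ← div_eq_inv_mul, le_div_iff₀ (Real.exp_pos _)]
  exact h

/-- The coordinates as continuous linear functionals. -/
def coordL (α : ℝ) (n : ℕ) : E α →L[ℂ] ℂ :=
  LinearMap.mkContinuous ⟨⟨fun u => u.seq n, fun _ _ => rfl⟩, fun _ _ => rfl⟩
    (Real.exp (-(α * n))) fun u => norm_seq_le u n

@[simp] theorem coordL_apply (n : ℕ) (u : E α) : coordL α n u = u.seq n := rfl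

/-- Coordinates of a Cauchy sequence converge, and the Cauchy bound on finite partial sums survives
this limit; being uniform in the number of terms, it controls the whole norm. -/
theorem completeSpace (α : ℝ) : CompleteSpace (E α) := by
  refine Metric.complete_of_cauchySeq_tendsto fun u hu => ?_
  have hc : ∀ n, ∃ z, Tendsto (fun j => (u j).seq n) atTop (𝓝 z) := fun n =>
    cauchySeq_tendsto_of_complete
      (hu.map (coordL α n).uniformContinuous)
  choose z hz using hc
  have key : ∀ ε > 0, ∃ J, ∀ j ≥ J, ∀ N,
      ∑ n ∈ Finset.range N, ‖(u j).seq n - z n‖ * Real.exp (α * n) ≤ ε := by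
    intro ε hε
    obtain ⟨J, hJ⟩ := Metric.cauchySeq_iff.1 hu ε hε
    refine ⟨J, fun j hj N => ?_⟩
    have ht : Tendsto (fun i => ∑ n ∈ Finset.range N, ‖(u j).seq n - (u i).seq n‖ *
        Real.exp (α * n)) atTop
        (𝓝 (∑ n ∈ Finset.range N, ‖(u j).seq n - z n‖ * Real.exp (α * n))) :=
      tendsto_finsetSum _ fun n _ => ((tendsto_const_nhds.sub (hz n)).norm.mul_const _)
    refine le_of_tendsto ht ?_
    filter_upwards [eventually_ge_atTop J] with i hi
    have h1 := sum_le_norm (u j - u i) (Finset.range N)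
    simp only [seq_sub] at h1
    have h2 := hJ j hj i hi
    rw [dist_eq_norm] at h2
    exact h1.trans h2.le
  have hsub : ∀ j J, (∀ N, ∑ n ∈ Finset.range N, ‖(u j).seq n - z n‖ * Real.exp (α * n) ≤ J) →
      Summable fun n : ℕ => ‖(u j).seq n - z n‖ * Real.exp (α * n) := fun j J h =>
    summable_of_sum_range_le (fun n => by positivity) h
  obtain ⟨J, hJ⟩ := key 1 one_pos
  have hs := hsub J 1 (hJ J le_rfl)
  have hz' : Summable fun n : ℕ => ‖z n‖ * Real.exp (α * n) := by
    refine Summable.of_nonneg_of_le (fun n => by positivity) (fun n => ?_) ((u J).summable.add hs)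
    rw [← add_mul]
    gcongr
    calc ‖z n‖ = ‖(u J).seq n - ((u J).seq n - z n)‖ := by rw [sub_sub_cancel]
      _ ≤ _ := norm_sub_le _ _
  refine ⟨E.mk z hz', Metric.tendsto_atTop.2 fun ε hε => ?_⟩
  obtain ⟨J, hJ⟩ := key (ε / 2) (half_pos hε)
  refine ⟨J, fun j hj => ?_⟩
  rw [dist_eq_norm]
  refine (norm_le_of_sum_le _ fun N => ?_).trans_lt (half_lt_self hε)
  simpa only [seq_sub, seq_mk] using hJ j hj N

end E

/-! ### Matrices as bounded operators between the spaces. -/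

/-- The columns of `m`, measured with the weights `e^{β n}`, are dominated by `C e^{γ k}`. -/
structure MatBound (m : ℕ → ℕ → ℂ) (β γ C : ℝ) : Prop where
  summable : ∀ k : ℕ, Summable fun n : ℕ => ‖m n k‖ * Real.exp (β * n)
  tsum_le : ∀ k : ℕ, ∑' n : ℕ, ‖m n k‖ * Real.exp (β * n) ≤ C * Real.exp (γ * k)

namespace MatBound

variable {m : ℕ → ℕ → ℂ} {β γ C : ℝ}

theorem nonneg (h : MatBound m β γ C) : 0 ≤ C := by
  have h0 := h.tsum_le 0
  simp only [Nat.cast_zero, mul_zero, Real.exp_zero, mul_one] at h0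
  exact (tsum_nonneg fun n => by positivity).trans h0

theorem mono {m' : ℕ → ℕ → ℂ} (h : MatBound m β γ C) (hm : ∀ n k, ‖m' n k‖ ≤ ‖m n k‖) :
    MatBound m' β γ C := by
  have hs : ∀ k : ℕ, Summable fun n : ℕ => ‖m' n k‖ * Real.exp (β * n) := fun k =>
    Summable.of_nonneg_of_le (fun n => by positivity)
      (fun n => mul_le_mul_of_nonneg_right (hm n k) (Real.exp_pos _).le) (h.summable k)
  exact ⟨hs, fun k => ((hs k).tsum_le_tsum (fun n =>
    mul_le_mul_of_nonneg_right (hm n k) (Real.exp_pos _).le) (h.summable k)).trans (h.tsum_le k)⟩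

theorem tsum_col_le (h : MatBound m β γ C) (u : E γ) (k : ℕ) :
    ∑' n : ℕ, ‖m n k * u.seq k‖ * Real.exp (β * n) ≤ C * (‖u.seq k‖ * Real.exp (γ * k)) := by
  have h1 : ∀ n : ℕ, ‖m n k * u.seq k‖ * Real.exp (β * n) =
      (‖m n k‖ * Real.exp (β * n)) * ‖u.seq k‖ := fun n => by rw [norm_mul]; ring
  simp_rw [h1]
  rw [tsum_mul_right]
  calc _ ≤ C * Real.exp (γ * k) * ‖u.seq k‖ :=
        mul_le_mul_of_nonneg_right (h.tsum_le k) (norm_nonneg _)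
    _ = _ := by ring

/-- Tonelli, summing down the columns first: the pair is (column, row), the order in which
`MatBound` gives control. -/
theorem summable_prod (h : MatBound m β γ C) (u : E γ) :
    Summable fun p : ℕ × ℕ => ‖m p.2 p.1 * u.seq p.1‖ * Real.exp (β * p.2) := by
  rw [summable_prod_of_nonneg fun p => by positivity]
  refine ⟨fun k => ?_, ?_⟩
  · have := (h.summable k).mul_right ‖u.seq k‖
    refine this.congr fun n => ?_
    simp only [norm_mul]
    ring
  · exact Summable.of_nonneg_of_le (fun k => tsum_nonneg fun n => by positivity)
      (fun k => h.tsum_col_le u k) (u.summable.mul_left C)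

theorem summable_swap (h : MatBound m β γ C) (u : E γ) :
    Summable fun p : ℕ × ℕ => ‖m p.1 p.2 * u.seq p.2‖ * Real.exp (β * p.1) :=
  (h.summable_prod u).prod_symm

theorem summable_norm_row (h : MatBound m β γ C) (u : E γ) (n : ℕ) :
    Summable fun k => ‖m n k * u.seq k‖ := by
  have h1 : Summable fun k => ‖m n k * u.seq k‖ * Real.exp (β * n) :=
    (h.summable_swap u).prod_factor n
  exact (summable_mul_right_iff (f := fun k => ‖m n k * u.seq k‖)
    (Real.exp_ne_zero (β * n))).1 h1

theorem hasSum_row (h : MatBound m β γ C) (u : E γ) (n : ℕ) :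
    HasSum (fun k => m n k * u.seq k) (∑' k, m n k * u.seq k) :=
  (h.summable_norm_row u n).of_norm.hasSum

theorem norm_row_le (h : MatBound m β γ C) (u : E γ) (n : ℕ) :
    ‖∑' k, m n k * u.seq k‖ * Real.exp (β * n) ≤
      ∑' k, ‖m n k * u.seq k‖ * Real.exp (β * n) := by
  rw [tsum_mul_right]
  exact mul_le_mul_of_nonneg_right (norm_tsum_le_tsum_norm (h.summable_norm_row u n))
    (Real.exp_pos _).le

theorem summable_apply (h : MatBound m β γ C) (u : E γ) :
    Summable fun n : ℕ => ‖∑' k, m n k * u.seq k‖ * Real.exp (β * n) :=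
  Summable.of_nonneg_of_le (fun n => by positivity) (h.norm_row_le u) (h.summable_swap u).prod

theorem tsum_apply_le (h : MatBound m β γ C) (u : E γ) :
    ∑' n : ℕ, ‖∑' k, m n k * u.seq k‖ * Real.exp (β * n) ≤ C * ‖u‖ := by
  calc _ ≤ ∑' n : ℕ, ∑' k, ‖m n k * u.seq k‖ * Real.exp (β * n) :=
        (h.summable_apply u).tsum_le_tsum (h.norm_row_le u) (h.summable_swap u).prod
    _ = ∑' k, ∑' n : ℕ, ‖m n k * u.seq k‖ * Real.exp (β * n) :=
        Summable.tsum_comm (f := fun k n : ℕ => ‖m n k * u.seq k‖ * Real.exp (β * n))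
          (h.summable_prod u)
    _ ≤ ∑' k : ℕ, C * (‖u.seq k‖ * Real.exp (γ * k)) :=
        (h.summable_prod u).prod.tsum_le_tsum (h.tsum_col_le u) (u.summable.mul_left C)
    _ = C * ‖u‖ := by rw [tsum_mul_left, E.norm_def]

/-- The bounded operator `E_γ → E_β` given by the matrix `m`. -/
def op (h : MatBound m β γ C) : E γ →L[ℂ] E β :=
  LinearMap.mkContinuous
    ⟨⟨fun u => E.mk (fun n => ∑' k, m n k * u.seq k) (h.summable_apply u), fun u v =>
      E.ext_seq fun n => by
        simp only [E.seq_mk, E.seq_add, mul_add]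
        exact (h.hasSum_row u n).summable.tsum_add (h.hasSum_row v n).summable⟩, fun z u =>
      E.ext_seq fun n => by
        simp only [E.seq_mk, E.seq_smul, RingHom.id_apply, ← tsum_mul_left, mul_left_comm]⟩
    C fun u => h.tsum_apply_le u

theorem op_seq (h : MatBound m β γ C) (u : E γ) (n : ℕ) :
    (h.op u).seq n = ∑' k, m n k * u.seq k := rfl

theorem hasSum_op (h : MatBound m β γ C) (u : E γ) (n : ℕ) :
    HasSum (fun k => m n k * u.seq k) ((h.op u).seq n) := h.hasSum_row u n

theorem norm_op_le (h : MatBound m β γ C) (u : E γ) : ‖h.op u‖ ≤ C * ‖u‖ := h.tsum_apply_le u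

end MatBound

/-! ### Truncation and column bounds. -/

/-- The matrix `-δ_{nk} d_n + e_{nk}`. -/
def sysMat (d : ℕ → ℝ) (e : ℕ → ℕ → ℂ) (n k : ℕ) : ℂ := -(if n = k then (d n : ℂ) else 0) + e n k

theorem coeff_eq_sysMat (d : ℕ → ℝ) (b c : ℕ → ℕ → ℂ) :
    coeff d b c = sysMat d fun n k => b n k + c n k := by
  funext n k
  simp only [coeff, sysMat, add_assoc]

theorem truncMat_sysMat (N : ℕ) (d : ℕ → ℝ) (e : ℕ → ℕ → ℂ) :
    truncMat N (sysMat d e) = sysMat (truncSeq N d) (truncMat N e) := by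
  funext n k
  simp only [truncMat, sysMat, truncSeq]
  by_cases hn : n ≤ N <;> by_cases hk : k ≤ N <;> simp [hn, hk]
  rintro rfl
  exact absurd hn hk

theorem coeff_trunc (N : ℕ) (d : ℕ → ℝ) (b c : ℕ → ℕ → ℂ) :
    coeff (truncSeq N d) (truncMat N b) (truncMat N c) = truncMat N (coeff d b c) := by
  rw [coeff_eq_sysMat, coeff_eq_sysMat, truncMat_sysMat]
  congr 1
  funext n k
  simp only [truncMat]
  split_ifs <;> simp

theorem norm_truncMat_le (N : ℕ) (m : ℕ → ℕ → ℂ) (n k : ℕ) : ‖truncMat N m n k‖ ≤ ‖m n k‖ := by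
  simp only [truncMat]
  split_ifs <;> simp

/-- Off-diagonal column bounds for the matrix `-δ_{nk} d_n + e_{nk}` in the weights `e^{β n}`, for
all `β ∈ [β₀, β₁]`: they make `∑ₙ |uₙ| e^{β(t) n}` grow at most like `e^{Kt}` when `β' = -lam`. -/
structure ColBound (d : ℕ → ℝ) (e : ℕ → ℕ → ℂ) (lam K β₀ β₁ : ℝ) : Prop where
  d_nonneg : ∀ n, 0 ≤ d n
  lam_nonneg : 0 ≤ lam
  K_nonneg : 0 ≤ K
  growth : ∀ ν : ℝ, 0 < ν → ∃ C, ∀ k : ℕ, d k ≤ C * Real.exp (ν * k)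
  summable : ∀ β, β₀ ≤ β → β ≤ β₁ → ∀ k : ℕ, Summable fun n : ℕ => ‖e n k‖ * Real.exp (β * n)
  tsum_le : ∀ β, β₀ ≤ β → β ≤ β₁ → ∀ k : ℕ, ∑' n : ℕ, ‖e n k‖ * Real.exp (β * n) ≤
    (d k + lam * k + K) * Real.exp (β * k)

/-- The tail condition on `c`, used with the exponent `β + 1 / k`. -/
theorem Conditions.tsum_c_le {αs : ℝ} {M : ℝ → ℝ} {a : ℕ → ℕ → ℂ} {d : ℕ → ℝ} {b c : ℕ → ℕ → ℂ}
    (hE : Conditions αs M a d b c) {β β₁ α : ℝ} (hβ : αs < β) (h₁ : β ≤ β₁) (hα : β₁ < α) (k : ℕ) :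
    ∑' n : ℕ, ‖c n k‖ * Real.exp (β * n) ≤
      (Real.exp 1 * M α * k + Real.exp 1 * M α / (α - β₁)) * Real.exp (β * k) := by
  have hM := hE.M_pos α (hβ.trans (h₁.trans_lt hα))
  have key : ∀ α₂, β < α₂ → α₂ ≤ α → (α₂ - β) * k ≤ 1 →
      ∑' n : ℕ, ‖c n k‖ * Real.exp (β * n) ≤
        Real.exp 1 * M α / (α₂ - β) * Real.exp (β * k) := by
    intro α₂ h2 h3 h4
    have h5 := (hE.c_bound β α₂ hβ h2 k).2
    have h6 : M α₂ ≤ M α :=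
      hE.M_increasing (mem_Ioi.2 (hβ.trans h2)) (mem_Ioi.2 (hβ.trans (h2.trans_le h3))) h3
    have h7 : 0 < α₂ - β := sub_pos.2 h2
    have h8 := hE.M_pos α₂ (hβ.trans h2)
    rw [neg_mul, Real.exp_neg, inv_mul_le_iff₀ (Real.exp_pos _)] at h5
    refine h5.trans ?_
    calc Real.exp (α₂ * k) * (M α₂ / (α₂ - β))
        ≤ Real.exp (1 + β * k) * (M α / (α₂ - β)) := by
          gcongr
          linarith
      _ = _ := by rw [Real.exp_add]; ring
  -- The best gap is `1/k`, but `α₂` may not exceed `α`. For small `k` the choice `α₂ = α` gives the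
  -- constant term, otherwise `α₂ = β + 1/k` gives the term linear in `k`.
  by_cases hk : (α - β) * k ≤ 1
  · refine (key α (h₁.trans_lt hα) le_rfl hk).trans ?_
    refine mul_le_mul_of_nonneg_right ?_ (Real.exp_pos _).le
    have h8 : Real.exp 1 * M α / (α - β) ≤ Real.exp 1 * M α / (α - β₁) := by
      have := sub_pos.2 hα
      gcongr
    have : 0 ≤ Real.exp 1 * M α * k := by positivity
    linarith
  · push Not at hk
    have hk0 : (0 : ℝ) < k := by
      rcases (Nat.cast_nonneg (α := ℝ) k).eq_or_lt with h | h
      · rw [← h, mul_zero] at hk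
        linarith
      · exact h
    have h9 := key (β + 1 / k) (by simpa using hk0)
      (by have : 1 / (k : ℝ) < α - β := by rwa [div_lt_iff₀ hk0]
          linarith) (by rw [add_sub_cancel_left, one_div_mul_cancel hk0.ne'])
    refine h9.trans (mul_le_mul_of_nonneg_right ?_ (Real.exp_pos _).le)
    rw [add_sub_cancel_left, div_div_eq_mul_div, div_one]
    have : 0 ≤ Real.exp 1 * M α / (α - β₁) := by
      have := sub_pos.2 hα
      positivity
    linarith

/-- The columns of `b` are absorbed by `d k`, for which `q ≤ 1` suffices; those of `c` give the
terms with `lam` and `K`. Keeping `β₁` below `α` makes `K` finite. -/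
theorem Conditions.colBound {αs : ℝ} {M : ℝ → ℝ} {a : ℕ → ℕ → ℂ} {d : ℕ → ℝ} {b c : ℕ → ℕ → ℂ}
    (hE : Conditions αs M a d b c) {β₀ β₁ α : ℝ} (h₀ : αs < β₀) (hα : β₁ < α) (hα' : αs < α) :
    ColBound d (fun n k => b n k + c n k) (Real.exp 1 * M α) (Real.exp 1 * M α / (α - β₁))
      β₀ β₁ := by
  have hM := hE.M_pos α hα'
  have hsub := sub_pos.2 hα
  have hs : ∀ β, β₀ ≤ β → β ≤ β₁ → ∀ k : ℕ,
      Summable fun n : ℕ => ‖b n k + c n k‖ * Real.exp (β * n) := by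
    intro β h1 h2 k
    obtain ⟨q, hq, hb⟩ := hE.b_bound β (h₀.trans_le h1)
    refine Summable.of_nonneg_of_le (fun n => by positivity) (fun n => ?_)
      ((hb k).1.add (hE.c_bound β α (h₀.trans_le h1) (h2.trans_lt hα) k).1)
    rw [← add_mul]
    exact mul_le_mul_of_nonneg_right (norm_add_le _ _) (Real.exp_pos _).le
  refine ⟨fun n => (hE.d_pos n).le, by positivity, by positivity, fun ν hν => ?_, hs, ?_⟩
  · obtain ⟨C, hC⟩ := hE.d_growth ν hν
    refine ⟨C, fun k => ?_⟩
    have h := hC (mem_range_self k)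
    simp only [neg_mul, Real.exp_neg] at h
    rwa [← div_eq_mul_inv, div_le_iff₀ (Real.exp_pos _)] at h
  · intro β h1 h2 k
    obtain ⟨q, hq, hb⟩ := hE.b_bound β (h₀.trans_le h1)
    have hc := (hE.c_bound β α (h₀.trans_le h1) (h2.trans_lt hα) k).1
    have hb' : ∑' n : ℕ, ‖b n k‖ * Real.exp (β * n) ≤ d k * Real.exp (β * k) := by
      have h := (hb k).2
      rw [neg_mul, Real.exp_neg, inv_mul_le_iff₀ (Real.exp_pos _)] at h
      refine h.trans ?_
      have := (hE.d_pos k).le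
      rw [mul_comm]
      gcongr
      nlinarith [hq.2]
    calc _ ≤ ∑' n : ℕ, (‖b n k‖ * Real.exp (β * n) + ‖c n k‖ * Real.exp (β * n)) := by
          refine (hs β h1 h2 k).tsum_le_tsum (fun n => ?_) ((hb k).1.add hc)
          rw [← add_mul]
          exact mul_le_mul_of_nonneg_right (norm_add_le _ _) (Real.exp_pos _).le
      _ = _ := (hb k).1.tsum_add hc
      _ ≤ _ := add_le_add hb' (hE.tsum_c_le (h₀.trans_le h1) h2 hα k)
      _ = _ := by ring

namespace ColBound

variable {d : ℕ → ℝ} {e : ℕ → ℕ → ℂ} {lam K β₀ β₁ : ℝ}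

/-- Columns up to `N` shrink while `d k` is kept, and later columns vanish. The constants do not
depend on `N`, which makes all estimates for truncated systems uniform. -/
theorem trunc (h : ColBound d e lam K β₀ β₁) (N : ℕ) :
    ColBound (truncSeq N d) (truncMat N e) lam K β₀ β₁ := by
  have hd : ∀ n, 0 ≤ truncSeq N d n := fun n => by
    simp only [truncSeq]
    split_ifs
    exacts [h.d_nonneg n, le_rfl]
  have hs : ∀ β, β₀ ≤ β → β ≤ β₁ → ∀ k : ℕ,
      Summable fun n : ℕ => ‖truncMat N e n k‖ * Real.exp (β * n) := fun β h1 h2 k =>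
    Summable.of_nonneg_of_le (fun n => by positivity)
      (fun n => mul_le_mul_of_nonneg_right (norm_truncMat_le N e n k) (Real.exp_pos _).le)
      (h.summable β h1 h2 k)
  refine ⟨hd, h.lam_nonneg, h.K_nonneg, fun ν hν => ?_, hs, fun β h1 h2 k => ?_⟩
  · obtain ⟨C, hC⟩ := h.growth ν hν
    refine ⟨C, fun k => le_trans ?_ (hC k)⟩
    simp only [truncSeq]
    split_ifs
    exacts [le_rfl, h.d_nonneg k]
  · by_cases hk : k ≤ N
    · have hdk : truncSeq N d k = d k := if_pos hk
      rw [hdk]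
      exact ((hs β h1 h2 k).tsum_le_tsum (fun n =>
        mul_le_mul_of_nonneg_right (norm_truncMat_le N e n k) (Real.exp_pos _).le)
        (h.summable β h1 h2 k)).trans (h.tsum_le β h1 h2 k)
    · have hz : ∀ n, truncMat N e n k = 0 := fun n => if_neg fun hh => hk hh.2
      simp only [hz, norm_zero, zero_mul, tsum_zero]
      have := hd k
      have := h.lam_nonneg
      have := h.K_nonneg
      positivity

/-- Both `d k` and `k` are at most a multiple of `e^{νk}`, so any loss in the exponent absorbs them.
In the constant, `2 * C` counts `d k` once for the diagonal and once for the column bound. -/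
theorem exists_matBound (h : ColBound d e lam K β₀ β₁) {ν : ℝ} (hν : 0 < ν) :
    ∃ C, ∀ β, β₀ ≤ β → β ≤ β₁ → MatBound (sysMat d e) β (β + ν) C := by
  obtain ⟨C, hC⟩ := h.growth ν hν
  refine ⟨2 * C + lam / ν + K, fun β h1 h2 => ?_⟩
  have hdiag : ∀ k : ℕ, HasSum (fun n : ℕ => (if n = k then d k * Real.exp (β * k) else 0))
      (d k * Real.exp (β * k)) := fun k => hasSum_ite_eq k _
  have hle : ∀ k n : ℕ, ‖sysMat d e n k‖ * Real.exp (β * n) ≤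
      (if n = k then d k * Real.exp (β * k) else 0) + ‖e n k‖ * Real.exp (β * n) := by
    intro k n
    have h3 : ‖sysMat d e n k‖ ≤ (if n = k then d k else 0) + ‖e n k‖ := by
      refine (norm_add_le _ _).trans (add_le_add_left (le_of_eq ?_) _)
      split_ifs with hnk
      · rw [norm_neg, Complex.norm_real, Real.norm_of_nonneg (h.d_nonneg n), hnk]
      · simp
    refine (mul_le_mul_of_nonneg_right h3 (Real.exp_pos _).le).trans (le_of_eq ?_)
    rw [add_mul]
    split_ifs with hnk
    · rw [hnk]
    · simp
  have hs : ∀ k : ℕ, Summable fun n : ℕ => ‖sysMat d e n k‖ * Real.exp (β * n) := fun k =>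
    Summable.of_nonneg_of_le (fun n => by positivity) (hle k)
      ((hdiag k).summable.add (h.summable β h1 h2 k))
  refine ⟨hs, fun k => ?_⟩
  have hone : 1 ≤ Real.exp (ν * k) := Real.one_le_exp (by positivity)
  have hk : (k : ℝ) ≤ Real.exp (ν * k) / ν := by
    rw [le_div_iff₀ hν]
    linarith [Real.add_one_le_exp (ν * k)]
  calc _ ≤ _ := (hs k).tsum_le_tsum (hle k) ((hdiag k).summable.add (h.summable β h1 h2 k))
    _ = d k * Real.exp (β * k) + ∑' n : ℕ, ‖e n k‖ * Real.exp (β * n) := by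
        rw [(hdiag k).summable.tsum_add (h.summable β h1 h2 k), (hdiag k).tsum_eq]
    _ ≤ d k * Real.exp (β * k) + (d k + lam * k + K) * Real.exp (β * k) :=
        add_le_add_right (h.tsum_le β h1 h2 k) _
    _ = (2 * d k + lam * k + K) * Real.exp (β * k) := by ring
    _ ≤ (2 * (C * Real.exp (ν * k)) + lam * (Real.exp (ν * k) / ν) + K * Real.exp (ν * k)) *
          Real.exp (β * k) := by
        have h3 := hC k
        have h4 := h.lam_nonneg
        have h5 : K ≤ K * Real.exp (ν * k) := le_mul_of_one_le_right h.K_nonneg hone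
        gcongr
    _ = _ := by rw [add_mul β, Real.exp_add]; ring

/-- What truncation at `N` removes from the matrix is exponentially small in `N`, as an operator
with a loss of `3 ε` in the exponent. -/
theorem exists_matBound_tail (h : ColBound d e lam K β₀ β₁) {ε : ℝ} (hε : 0 < ε) :
    ∃ C, ∀ (N : ℕ) (β : ℝ), β₀ ≤ β → β + ε ≤ β₁ →
      MatBound (sysMat d e - truncMat N (sysMat d e)) β (β + 3 * ε) (C * Real.exp (-ε * N)) := by
  obtain ⟨C, hC⟩ := h.exists_matBound hε
  refine ⟨C, fun N β h1 h2 => ?_⟩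
  have hB := hC (β + ε) (by linarith) h2
  have hle : ∀ k n : ℕ, ‖(sysMat d e - truncMat N (sysMat d e)) n k‖ * Real.exp (β * n) ≤
      (Real.exp (-ε * N) * Real.exp (ε * k)) *
        (‖sysMat d e n k‖ * Real.exp ((β + ε) * n)) := by
    intro k n
    simp only [Pi.sub_apply, truncMat]
    split_ifs with hnk
    · rw [sub_self, norm_zero, zero_mul]
      positivity
    · rw [sub_zero, mul_left_comm]
      refine mul_le_mul_of_nonneg_left ?_ (norm_nonneg _)
      rw [← Real.exp_add, ← Real.exp_add, Real.exp_le_exp]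
      -- A removed entry has `n > N` or `k > N`, so `e^{-εN} e^{εn} e^{εk} ≥ 1`. The losses are `ε`
      -- for the row, `ε` for the column and `ε` for boundedness.
      have : (N : ℝ) ≤ n + k := by
        have : N ≤ n + k := by omega
        exact_mod_cast this
      nlinarith
  have hs : ∀ k : ℕ, Summable fun n : ℕ =>
      ‖(sysMat d e - truncMat N (sysMat d e)) n k‖ * Real.exp (β * n) := fun k =>
    Summable.of_nonneg_of_le (fun n => by positivity) (hle k) ((hB.summable k).mul_left _)
  refine ⟨hs, fun k => ?_⟩
  calc _ ≤ _ := (hs k).tsum_le_tsum (hle k) ((hB.summable k).mul_left _)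
    _ = Real.exp (-ε * N) * Real.exp (ε * k) *
          ∑' n : ℕ, ‖sysMat d e n k‖ * Real.exp ((β + ε) * n) := tsum_mul_left
    _ ≤ Real.exp (-ε * N) * Real.exp (ε * k) * (C * Real.exp ((β + ε + ε) * k)) := by
        gcongr
        exact hB.tsum_le k
    _ = _ := by
        rw [show (β + 3 * ε) * (k : ℝ) = ε * k + (β + ε + ε) * k by ring, Real.exp_add]
        ring

end ColBound

/-! ### The a priori estimate with moving weights. -/

/-- A damping term `-μ y` contributes `-μ ‖y‖` to the right upper derivative of the norm. -/
theorem eventually_slope_norm_lt {F : Type*} [NormedAddCommGroup F] [NormedSpace ℝ F] {y : ℝ → F}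
    {t μ : ℝ} {g : F} (hy : HasDerivWithinAt y (-(μ • y t) + g) (Ici t) t) {r : ℝ}
    (hr : -μ * ‖y t‖ + ‖g‖ < r) :
    ∀ᶠ s in 𝓝[>] t, (s - t)⁻¹ * (‖y s‖ - ‖y t‖) < r := by
  obtain ⟨δ, hδ, hδr⟩ : ∃ δ > 0, -μ * ‖y t‖ + ‖g‖ + δ < r :=
    ⟨(r - (-μ * ‖y t‖ + ‖g‖)) / 2, by linarith, by linarith⟩
  have h1 := (hasDerivWithinAt_iff_isLittleO.1 (hy.mono Ioi_subset_Ici_self)).def hδ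
  have h2 : ∀ᶠ s in 𝓝[>] t, (s - t) * μ < 1 := by
    have : Tendsto (fun s => (s - t) * μ) (𝓝[>] t) (𝓝 ((t - t) * μ)) :=
      Tendsto.mono_left (Continuous.tendsto (by fun_prop) t) nhdsWithin_le_nhds
    rw [sub_self, zero_mul] at this
    exact this.eventually_lt_const one_pos
  filter_upwards [h1, h2, self_mem_nhdsWithin] with s hs1 hs2 hs3
  have hst : 0 < s - t := sub_pos.2 hs3
  rw [Real.norm_of_nonneg hst.le] at hs1
  -- Keeping the damping inside the coefficient of `y t`, which is positive for `s` near `t`,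
  -- preserves its sign under the triangle inequality.
  have hdec : y s = (1 - (s - t) * μ) • y t + (s - t) • g +
      (y s - y t - (s - t) • (-(μ • y t) + g)) := by
    module
  have hn : ‖y s‖ ≤ (1 - (s - t) * μ) * ‖y t‖ + (s - t) * ‖g‖ + δ * (s - t) := by
    calc ‖y s‖ ≤ ‖(1 - (s - t) * μ) • y t‖ + ‖(s - t) • g‖ +
          ‖y s - y t - (s - t) • (-(μ • y t) + g)‖ := by
          nth_rewrite 1 [hdec]
          exact norm_add₃_le
      _ ≤ _ := by
          rw [norm_smul, norm_smul, Real.norm_of_nonneg hst.le,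
            Real.norm_of_nonneg (by linarith : 0 ≤ 1 - (s - t) * μ)]
          gcongr
  rw [inv_mul_lt_iff₀ hst]
  nlinarith

theorem gronwallBound_zero_left (K ε x : ℝ) :
    gronwallBound 0 K ε x = ε * gronwallBound 0 K 1 x := by
  unfold gronwallBound
  split_ifs <;> ring

/-- A priori estimate for finite inhomogeneous systems in the norm with the moving weights
`e^{β(t) n}`, where `β(t) = β₂ - lam (t - t₀)`. -/
theorem ColBound.sum_le_gronwallBound {d : ℕ → ℝ} {e : ℕ → ℕ → ℂ} {lam K β₀ β₁ : ℝ}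
    (h : ColBound d e lam K β₀ β₁) (s : Finset ℕ) {z f : ℕ → ℝ → ℂ} {t₀ t₁ β₂ Φ F : ℝ}
    (hβ₂ : β₂ ≤ β₁) (hβ₀ : β₀ ≤ β₂ - lam * (t₁ - t₀))
    (hc : ∀ n ∈ s, ContinuousOn (z n) (Icc t₀ t₁))
    (hz : ∀ t ∈ Ico t₀ t₁, ∀ n ∈ s, HasDerivWithinAt (z n)
      (∑ k ∈ s, sysMat d e n k * z k t + f n t) (Ici t) t)
    (hf : ∀ t ∈ Ico t₀ t₁,
      ∑ n ∈ s, ‖f n t‖ * Real.exp ((β₂ - lam * (t - t₀)) * n) ≤ F)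
    (h₀ : ∑ n ∈ s, ‖z n t₀‖ * Real.exp (β₂ * n) ≤ Φ) {t : ℝ} (ht : t ∈ Icc t₀ t₁) :
    ∑ n ∈ s, ‖z n t‖ * Real.exp ((β₂ - lam * (t - t₀)) * n) ≤
      gronwallBound Φ K F (t - t₀) := by
  set w : ℕ → ℝ → ℝ := fun n t => Real.exp ((β₂ - lam * (t - t₀)) * n) with hw
  have hw0 : ∀ n t, 0 < w n t := fun n t => Real.exp_pos _
  have hwd : ∀ n t, HasDerivAt (w n) (-(lam * n) * w n t) t := by
    intro n t
    have h1 : HasDerivAt (fun t => (β₂ - lam * (t - t₀)) * n) (-(lam * n)) t := by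
      have := ((((hasDerivAt_id t).sub_const t₀).const_mul lam).const_sub β₂).mul_const (n : ℝ)
      convert! this using 1
      ring
    have := h1.exp
    rwa [mul_comm] at this
  set y : ℕ → ℝ → ℂ := fun n t => w n t • z n t with hy
  have hyn : ∀ n t, ‖y n t‖ = ‖z n t‖ * w n t := fun n t => by
    rw [hy, norm_smul, Real.norm_of_nonneg (hw0 n t).le, mul_comm]
  set g : ℕ → ℝ → ℂ := fun n t => w n t • (∑ k ∈ s, e n k * z k t + f n t) with hg
  have hyd : ∀ t ∈ Ico t₀ t₁, ∀ n ∈ s,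
      HasDerivWithinAt (y n) (-((d n + lam * n) • y n t) + g n t) (Ici t) t := by
    intro t ht n hn
    have h1 := (hwd n t).hasDerivWithinAt.smul (hz t ht n hn)
    refine h1.congr_deriv ?_
    have h2 : ∑ k ∈ s, sysMat d e n k * z k t = -(d n * z n t) + ∑ k ∈ s, e n k * z k t := by
      simp only [sysMat, add_mul, Finset.sum_add_distrib, neg_mul, Finset.sum_neg_distrib,
        ite_mul, zero_mul, Finset.sum_ite_eq, if_pos hn]
    rw [h2, hg, hy]
    simp only [Complex.real_smul]
    push_cast
    ring
  have hbound : ∀ t ∈ Ico t₀ t₁, ∑ n ∈ s, (-(d n + lam * n) * ‖y n t‖ + ‖g n t‖) ≤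
      K * ∑ n ∈ s, ‖y n t‖ + F := by
    intro t ht
    have h1 : β₂ - lam * (t - t₀) ≤ β₁ := by
      have := mul_nonneg h.lam_nonneg (sub_nonneg.2 ht.1)
      linarith
    have h2 : β₀ ≤ β₂ - lam * (t - t₀) := by
      have := mul_le_mul_of_nonneg_left (sub_le_sub_right ht.2.le t₀) h.lam_nonneg
      linarith
    have hcol : ∀ k, ∑ n ∈ s, ‖e n k‖ * w n t ≤ (d k + lam * k + K) * w k t := fun k =>
      ((h.summable _ h2 h1 k).sum_le_tsum s fun n _ => by positivity).trans
        (h.tsum_le _ h2 h1 k)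
    have hgn : ∀ n, ‖g n t‖ ≤ ∑ k ∈ s, ‖e n k‖ * w n t * ‖z k t‖ + ‖f n t‖ * w n t := by
      intro n
      rw [hg, norm_smul, Real.norm_of_nonneg (hw0 n t).le]
      calc _ ≤ w n t * (∑ k ∈ s, ‖e n k * z k t‖ + ‖f n t‖) := by
            gcongr
            exact (norm_add_le _ _).trans (by gcongr; exact norm_sum_le _ _)
        _ = _ := by
            rw [mul_add, Finset.mul_sum, mul_comm (w n t) ‖f n t‖]
            congr 1
            refine Finset.sum_congr rfl fun k _ => ?_
            rw [norm_mul]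
            ring
    calc ∑ n ∈ s, (-(d n + lam * n) * ‖y n t‖ + ‖g n t‖)
        ≤ ∑ n ∈ s, (-(d n + lam * n) * ‖y n t‖ +
            (∑ k ∈ s, ‖e n k‖ * w n t * ‖z k t‖ + ‖f n t‖ * w n t)) := by
          gcongr with n _
          exact hgn n
      _ = ∑ k ∈ s, (-(d k + lam * k) * ‖y k t‖ + (∑ n ∈ s, ‖e n k‖ * w n t) * ‖z k t‖) +
            ∑ n ∈ s, ‖f n t‖ * w n t := by
          simp only [Finset.sum_add_distrib, Finset.sum_mul]
          rw [Finset.sum_comm (f := fun n k => ‖e n k‖ * w n t * ‖z k t‖)]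
          ring
      -- After exchanging the sums, the column bound cancels `-(d k + lam * k)` and only `K` is
      -- left.
      _ ≤ ∑ k ∈ s, K * ‖y k t‖ + F := by
          refine add_le_add (Finset.sum_le_sum fun k _ => ?_) (hf t ht)
          have := mul_le_mul_of_nonneg_right (hcol k) (norm_nonneg (z k t))
          rw [hyn]
          linarith
      _ = _ := by rw [Finset.mul_sum]
  -- The norms need not be differentiable where a component vanishes, so Gronwall is applied with
  -- right difference quotients.
  have key := le_gronwallBound_of_liminf_deriv_right_le (f := fun t => ∑ n ∈ s, ‖y n t‖)
    (f' := fun t => ∑ n ∈ s, (-(d n + lam * n) * ‖y n t‖ + ‖g n t‖)) (δ := Φ) (K := K) (ε := F)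
    (a := t₀) (b := t₁) ?_ ?_ ?_ hbound t ht
  · simpa only [hyn] using key
  · refine continuousOn_finsetSum _ fun n hn => ContinuousOn.norm ?_
    exact ContinuousOn.smul (fun t _ => (hwd n t).continuousAt.continuousWithinAt) (hc n hn)
  · intro t ht r hr
    obtain ⟨δ, hδ, hδr⟩ : ∃ δ > 0,
        ∑ n ∈ s, (-(d n + lam * n) * ‖y n t‖ + ‖g n t‖ + δ) < r := by
      refine ⟨(r - ∑ n ∈ s, (-(d n + lam * n) * ‖y n t‖ + ‖g n t‖)) / (s.card + 1),
        div_pos (sub_pos.2 hr) (by positivity), ?_⟩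
      rw [Finset.sum_add_distrib, Finset.sum_const, nsmul_eq_mul]
      have h1 : (s.card : ℝ) * ((r - ∑ n ∈ s, (-(d n + lam * n) * ‖y n t‖ + ‖g n t‖)) /
          (s.card + 1)) < r - ∑ n ∈ s, (-(d n + lam * n) * ‖y n t‖ + ‖g n t‖) := by
        rw [mul_div_assoc', div_lt_iff₀ (by positivity)]
        nlinarith [sub_pos.2 hr]
      linarith
    have hev : ∀ᶠ τ in 𝓝[>] t, ∀ n ∈ s, (τ - t)⁻¹ * (‖y n τ‖ - ‖y n t‖) <
        -(d n + lam * n) * ‖y n t‖ + ‖g n t‖ + δ :=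
      (eventually_all_finset s).2 fun n hn =>
        eventually_slope_norm_lt (hyd t ht n hn) (lt_add_of_pos_right _ hδ)
    refine (hev.mono fun τ hτ => ?_).frequently
    rw [← Finset.sum_sub_distrib, Finset.mul_sum]
    exact (Finset.sum_le_sum fun n hn => (hτ n hn).le).trans_lt hδr
  · refine le_trans (le_of_eq (Finset.sum_congr rfl fun n _ => ?_)) h₀
    simp [hyn, hw]

theorem tendsto_exp_neg_mul_nat {ε : ℝ} (hε : 0 < ε) :
    Tendsto (fun N : ℕ => Real.exp (-ε * N)) atTop (𝓝 0) := by
  refine Real.tendsto_exp_atBot.comp ?_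
  exact tendsto_natCast_atTop_atTop.const_mul_atTop_of_neg (neg_lt_zero.2 hε)

theorem hasSum_truncMat_row {N n : ℕ} (hn : n ≤ N) (m : ℕ → ℕ → ℂ) (u : ℕ → ℂ) :
    HasSum (fun k => truncMat N m n k * u k) (∑ k ∈ Finset.range (N + 1), m n k * u k) := by
  have h1 : ∑ k ∈ Finset.range (N + 1), m n k * u k =
      ∑ k ∈ Finset.range (N + 1), truncMat N m n k * u k := by
    refine Finset.sum_congr rfl fun k hk => ?_
    rw [truncMat, if_pos ⟨hn, Nat.lt_succ_iff.1 (Finset.mem_range.1 hk)⟩]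
  rw [h1]
  refine hasSum_sum_of_ne_finset_zero fun k hk => ?_
  rw [truncMat, if_neg fun h => hk (Finset.mem_range.2 (Nat.lt_succ_of_le h.2)), zero_mul]

/-! ### Uniqueness of classical solutions. -/

section Uniqueness

variable {d : ℕ → ℝ} {e : ℕ → ℕ → ℂ} {lam K β₀ β₁ α' : ℝ}

/-- The components up to `N` solve a finite system whose inhomogeneity is the discarded tail applied
to `w`. Starting at the exponent `β₁ - ε`, the loss `3ε` ends at `β₁ + 2ε ≤ α'`, where `w` is
bounded. The error is `O(e^{-εN})`, and `N → ∞` gives zero. -/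
theorem ColBound.eq_zero_of_short_time (h : ColBound d e lam K β₀ β₁) {ε t₀ t₁ R : ℝ}
    (hε : 0 < ε) (hα' : β₁ + 2 * ε ≤ α') (ht : β₀ ≤ β₁ - ε - lam * (t₁ - t₀))
    {w : ℝ → E α'} {v : ℝ → ℕ → ℂ} (hc : ContinuousOn w (Icc t₀ t₁))
    (hR : ∀ t ∈ Icc t₀ t₁, ‖w t‖ ≤ R)
    (hd : ∀ t ∈ Ico t₀ t₁, ∀ n, HasDerivWithinAt (fun s => (w s).seq n) (v t n) (Ici t) t)
    (hv : ∀ t ∈ Ico t₀ t₁, ∀ n, HasSum (fun k => sysMat d e n k * (w t).seq k) (v t n))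
    (h₀ : w t₀ = 0) {t : ℝ} (htm : t ∈ Icc t₀ t₁) : w t = 0 := by
  obtain ⟨C, hC⟩ := h.exists_matBound_tail hε
  set f : ℕ → ℕ → ℝ → ℂ := fun N n t =>
    ∑' k, (sysMat d e - truncMat N (sysMat d e)) n k * (w t).seq k with hf
  have hest : ∀ N : ℕ, ∑ n ∈ Finset.range (N + 1),
      ‖(w t).seq n‖ * Real.exp ((β₁ - ε - lam * (t - t₀)) * n) ≤
        C * Real.exp (-ε * N) * R * gronwallBound 0 K 1 (t - t₀) := by
    intro N
    have hβ : ∀ t ∈ Ico t₀ t₁, β₀ ≤ β₁ - ε - lam * (t - t₀) ∧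
        β₁ - ε - lam * (t - t₀) ≤ β₁ - ε := by
      intro t ht
      have h1 := mul_nonneg h.lam_nonneg (sub_nonneg.2 ht.1)
      have h2 := mul_le_mul_of_nonneg_left (sub_le_sub_right ht.2.le t₀) h.lam_nonneg
      exact ⟨by linarith, by linarith⟩
    rw [← gronwallBound_zero_left]
    refine h.sum_le_gronwallBound (Finset.range (N + 1)) (z := fun n t => (w t).seq n)
      (f := f N) (by linarith) ht (fun n _ => (E.coordL α' n).continuous.comp_continuousOn hc)
      (fun t htt n hn => ?_) (fun t htt => ?_) ?_ htm
    · refine (hd t htt n).congr_deriv ?_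
      have hn' : n ≤ N := Nat.lt_succ_iff.1 (Finset.mem_range.1 hn)
      have h1 := hasSum_truncMat_row hn' (sysMat d e) (w t).seq
      have h2 := (hv t htt n).sub h1
      have h3 : f N n t = _ := HasSum.tsum_eq (by
        simpa only [Pi.sub_apply, sub_mul] using h2)
      rw [h3, add_sub_cancel]
    · obtain ⟨h1, h2⟩ := hβ t htt
      have hB := hC N _ h1 (by linarith)
      have hle : β₁ - ε - lam * (t - t₀) + 3 * ε ≤ α' := by linarith
      have h3 := E.sum_le_norm (hB.op (E.incl hle (w t))) (Finset.range (N + 1))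
      simp only [MatBound.op_seq, E.seq_incl] at h3
      refine h3.trans ((hB.norm_op_le _).trans ?_)
      exact mul_le_mul_of_nonneg_left ((E.norm_incl_le _ _).trans (hR t ⟨htt.1, htt.2.le⟩))
        hB.nonneg
    · simp [h₀]
  refine E.ext_seq fun n => ?_
  have hlim : Tendsto (fun N : ℕ => C * Real.exp (-ε * N) * R * gronwallBound 0 K 1 (t - t₀))
      atTop (𝓝 (C * 0 * R * gronwallBound 0 K 1 (t - t₀))) :=
    (((tendsto_exp_neg_mul_nat hε).const_mul C).mul_const R).mul_const _
  have h1 : ‖(w t).seq n‖ * Real.exp ((β₁ - ε - lam * (t - t₀)) * n) ≤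
      C * 0 * R * gronwallBound 0 K 1 (t - t₀) := by
    refine ge_of_tendsto hlim ?_
    filter_upwards [eventually_ge_atTop n] with N hN
    refine le_trans ?_ (hest N)
    exact Finset.single_le_sum (f := fun n : ℕ => ‖(w t).seq n‖ *
      Real.exp ((β₁ - ε - lam * (t - t₀)) * n)) (fun i _ => by positivity)
      (Finset.mem_range.2 (Nat.lt_succ_of_le hN))
  rw [mul_zero, zero_mul, zero_mul] at h1
  have h2 : ‖(w t).seq n‖ ≤ 0 := by
    by_contra hcon
    push Not at hcon
    exact absurd h1 (not_le.2 (mul_pos hcon (Real.exp_pos _)))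
  rw [norm_le_zero_iff.1 h2, E.seq_zero]

theorem ColBound.eqOn_zero (h : ColBound d e lam K β₀ β₁) (hβ : β₀ < β₁) (hα' : β₁ < α') {T : ℝ}
    {w : ℝ → E α'} {v : ℝ → ℕ → ℂ} (hc : ContinuousOn w (Ico 0 T))
    (hd : ∀ t ∈ Ico 0 T, ∀ n, HasDerivWithinAt (fun s => (w s).seq n) (v t n) (Ici t) t)
    (hv : ∀ t ∈ Ico 0 T, ∀ n, HasSum (fun k => sysMat d e n k * (w t).seq k) (v t n))
    (h₀ : w 0 = 0) : ∀ t ∈ Ico 0 T, w t = 0 := by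
  obtain ⟨ε, hε, hε1, hε2⟩ : ∃ ε > 0, β₁ + 2 * ε ≤ α' ∧ β₀ < β₁ - ε := by
    refine ⟨min ((α' - β₁) / 2) ((β₁ - β₀) / 2), lt_min (by linarith) (by linarith), ?_, ?_⟩
    · linarith [min_le_left ((α' - β₁) / 2) ((β₁ - β₀) / 2)]
    · linarith [min_le_right ((α' - β₁) / 2) ((β₁ - β₀) / 2)]
  -- The step length depends only on `lam` and the exponents. As `w` stays in `E α'`, each step
  -- restarts at the exponent `β₁ - ε`, and the steps cover `[0, T)`.
  obtain ⟨δ, hδ, hlam⟩ : ∃ δ > 0, lam * δ ≤ β₁ - ε - β₀ := by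
    refine ⟨(β₁ - ε - β₀) / (lam + 1), div_pos (by linarith)
      (by linarith [h.lam_nonneg]), ?_⟩
    rw [mul_div_assoc', div_le_iff₀ (by linarith [h.lam_nonneg])]
    nlinarith
  have step : ∀ j : ℕ, ∀ t ∈ Ico 0 T, t ≤ j * δ → w t = 0 := by
    intro j
    induction j with
    | zero =>
      intro t ht htj
      rw [Nat.cast_zero, zero_mul] at htj
      rw [le_antisymm htj ht.1, h₀]
    | succ j ih =>
      intro t ht htj
      by_cases hcase : t ≤ j * δ
      · exact ih t ht hcase
      push Not at hcase
      have hj0 : 0 ≤ (j : ℝ) * δ := by positivity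
      have hj : (j : ℝ) * δ ∈ Ico 0 T := ⟨hj0, hcase.trans ht.2⟩
      have hsub : Icc ((j : ℝ) * δ) t ⊆ Ico 0 T := fun s hs =>
        ⟨hj0.trans hs.1, hs.2.trans_lt ht.2⟩
      have hsub' : Ico ((j : ℝ) * δ) t ⊆ Ico 0 T := Ico_subset_Icc_self.trans hsub
      obtain ⟨R, hR⟩ := isCompact_Icc.exists_bound_of_continuousOn (hc.mono hsub)
      refine h.eq_zero_of_short_time hε hε1 ?_ (hc.mono hsub) hR
        (fun s hs => hd s (hsub' hs)) (fun s hs => hv s (hsub' hs)) (ih _ hj le_rfl)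
        (right_mem_Icc.2 hcase.le)
      have h1 : t - j * δ ≤ δ := by
        push_cast at htj
        linarith
      have h2 := mul_le_mul_of_nonneg_left h1 h.lam_nonneg
      linarith
  intro t ht
  obtain ⟨j, hj⟩ := exists_nat_ge (t / δ)
  exact step j t ht ((div_le_iff₀ hδ).1 hj)

end Uniqueness

/-- The coordinates of a classical solution are differentiable from the right. -/
theorem IsClassicalSolution.exists_coord_deriv {αs α' T : ℝ} {a : ℕ → ℕ → ℂ} {x : ℕ → ℂ}
    {u : ℝ → E α'} (hu : IsClassicalSolution αs α' T a x u) (hα' : αs < α') :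
    ∃ v : ℝ → ℕ → ℂ, ∀ t ∈ Ico 0 T, ∀ n,
      HasDerivWithinAt (fun s => (u s).seq n) (v t n) (Ici t) t ∧
        HasSum (fun k => a n k * (u t).seq k) (v t n) := by
  obtain ⟨α'', h1, h2⟩ := exists_between hα'
  obtain ⟨w, -, hw⟩ := hu.equation α'' h1 h2
  refine ⟨fun t => (w t).seq, fun t ht n => ⟨?_, (hw t ht).2 n⟩⟩
  have h3 : HasDerivWithinAt (fun s => E.coordL α'' n (E.incl h2.le (u s)))
      (E.coordL α'' n (w t)) (Ico 0 T) t :=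
    ((E.coordL α'' n).restrictScalars ℝ).hasFDerivAt.comp_hasDerivWithinAt t (hw t ht).1
  simp only [E.coordL_apply, E.seq_incl] at h3
  exact h3.mono_of_mem_nhdsWithin
    (mem_of_superset (Ico_mem_nhdsGE ht.2) (Ico_subset_Ico_left ht.1))

theorem ColBound.eqOn_of_isClassicalSolution {d : ℕ → ℝ} {e : ℕ → ℕ → ℂ}
    {lam K β₀ β₁ αs α' T : ℝ} (h : ColBound d e lam K β₀ β₁) (hαs : αs < β₀) (hβ : β₀ < β₁)
    (hα' : β₁ < α') {x : ℕ → ℂ} {u v : ℝ → E α'}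
    (hu : IsClassicalSolution αs α' T (sysMat d e) x u)
    (hv : IsClassicalSolution αs α' T (sysMat d e) x v) : EqOn v u (Ico 0 T) := by
  have hlt : αs < α' := hαs.trans (hβ.trans hα')
  obtain ⟨u', hu'⟩ := hu.exists_coord_deriv hlt
  obtain ⟨v', hv'⟩ := hv.exists_coord_deriv hlt
  intro t ht
  rw [← sub_eq_zero]
  refine h.eqOn_zero hβ hα' (w := fun s => v s - u s) (v := fun s n => v' s n - u' s n)
    (hv.continuousOn.sub hu.continuousOn) (fun s hs n => ?_) (fun s hs n => ?_) ?_ t ht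
  · exact (hv' s hs n).1.sub (hu' s hs n).1
  · simpa only [E.seq_sub, mul_sub] using (hv' s hs n).2.sub (hu' s hs n).2
  · refine E.ext_seq fun n => ?_
    simp [hv.initial, hu.initial]

/-! ### Limits of derivatives and solutions of truncated systems. -/

/-- Termwise differentiation on a convex set of reals, endpoints included. -/
theorem hasDerivWithinAt_of_tendstoUniformlyOn {F : Type*} [NormedAddCommGroup F]
    [NormedSpace ℝ F] {S : Set ℝ} (hS : Convex ℝ S) {f g : ℝ → F} {fN gN : ℕ → ℝ → F}
    (hd : ∀ N, ∀ t ∈ S, HasDerivWithinAt (fN N) (gN N t) S t)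
    (hf : ∀ t ∈ S, Tendsto (fun N => fN N t) atTop (𝓝 (f t)))
    (hg : TendstoUniformlyOn gN g atTop S) (hc : ContinuousOn g S) {t : ℝ} (ht : t ∈ S) :
    HasDerivWithinAt f (g t) S t := by
  rw [hasDerivWithinAt_iff_isLittleO, Asymptotics.isLittleO_iff]
  intro ε hε
  obtain ⟨r, hr, hball⟩ := Metric.continuousOn_iff.1 hc t ht (ε / 2) (half_pos hε)
  have hmem : S ∩ Metric.ball t r ∈ 𝓝[S] t :=
    inter_mem self_mem_nhdsWithin (mem_nhdsWithin_of_mem_nhds (Metric.ball_mem_nhds t hr))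
  filter_upwards [hmem] with s hs
  have hconv : Convex ℝ (S ∩ Metric.ball t r) := hS.inter (convex_ball t r)
  -- Mean value inequality for `fN N τ - τ • g t`, whose derivative is at most `ε` near `t`
  -- uniformly in large `N`.
  have hev : ∀ᶠ N in atTop, ‖fN N s - fN N t - (s - t) • g t‖ ≤ ε * ‖s - t‖ := by
    filter_upwards [Metric.tendstoUniformlyOn_iff.1 hg (ε / 2) (half_pos hε)] with N hN
    have key := hconv.norm_image_sub_le_of_norm_hasDerivWithin_le
      (f := fun τ => fN N τ - τ • g t) (f' := fun τ => gN N τ - g t) (C := ε)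
      (fun τ hτ => ?_) (fun τ hτ => ?_) ⟨ht, Metric.mem_ball_self hr⟩ hs
    · convert! key using 2
      module
    · have h1 := (hd N τ hτ.1).mono (inter_subset_left (t := Metric.ball t r))
      have h2 : HasDerivWithinAt (fun τ : ℝ => τ • g t) (g t) (S ∩ Metric.ball t r) τ := by
        simpa using (hasDerivWithinAt_id τ (S ∩ Metric.ball t r)).smul_const (g t)
      exact h1.sub h2
    · have h1 := hN τ hτ.1
      have h2 := hball τ hτ.1 hτ.2
      rw [dist_eq_norm] at h1 h2
      rw [norm_sub_rev] at h1
      calc ‖gN N τ - g t‖ = ‖(gN N τ - g τ) + (g τ - g t)‖ := by rw [sub_add_sub_cancel]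
        _ ≤ _ := norm_add_le _ _
        _ ≤ ε := by linarith
  exact le_of_tendsto ((((hf s hs.1).sub (hf t ht)).sub_const _).norm) hev

theorem exists_matBound_truncMat (N : ℕ) (m : ℕ → ℕ → ℂ) (β γ : ℝ) :
    ∃ C, MatBound (truncMat N m) β γ C := by
  set c : ℕ → ℝ := fun k => ∑ n ∈ Finset.range (N + 1), ‖truncMat N m n k‖ * Real.exp (β * n)
    with hc
  have hc0 : ∀ k, 0 ≤ c k := fun k => Finset.sum_nonneg fun n _ => by positivity
  have hs : ∀ k : ℕ, HasSum (fun n : ℕ => ‖truncMat N m n k‖ * Real.exp (β * n)) (c k) :=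
    fun k => hasSum_sum_of_ne_finset_zero fun n hn => by
      rw [truncMat, if_neg fun h => hn (Finset.mem_range.2 (Nat.lt_succ_of_le h.1)), norm_zero,
        zero_mul]
  refine ⟨∑ k ∈ Finset.range (N + 1), c k / Real.exp (γ * k), fun k => (hs k).summable,
    fun k => ?_⟩
  rw [(hs k).tsum_eq]
  by_cases hk : k ∈ Finset.range (N + 1)
  · rw [← div_le_iff₀ (Real.exp_pos _)]
    exact Finset.single_le_sum (f := fun k : ℕ => c k / Real.exp (γ * k))
      (fun k _ => div_nonneg (hc0 k) (Real.exp_pos _).le) hk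
  · have : c k = 0 := Finset.sum_eq_zero fun n _ => by
      rw [truncMat, if_neg fun h => hk (Finset.mem_range.2 (Nat.lt_succ_of_le h.2)), norm_zero,
        zero_mul]
    rw [this]
    exact mul_nonneg (Finset.sum_nonneg fun k _ => div_nonneg (hc0 k) (Real.exp_pos _).le)
      (Real.exp_pos _).le

theorem MatBound.exists_solution {m : ℕ → ℕ → ℂ} {γ C : ℝ} (hB : MatBound m γ γ C) (x : E γ) :
    ∃ u : ℝ → E γ, u 0 = x ∧ ∀ t, HasDerivAt u (hB.op (u t)) t := by
  have := E.completeSpace γ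
  refine ⟨fun t => NormedSpace.exp ((t : ℂ) • hB.op) x, by simp, fun t => ?_⟩
  have h1 := (hasDerivAt_exp_smul_const' hB.op (t : ℂ)).scomp t Complex.ofRealCLM.hasDerivAt
  rw [Complex.ofRealCLM_apply, Complex.ofReal_one, one_smul] at h1
  have h2 := ((ContinuousLinearMap.apply ℂ (E γ) x).restrictScalars ℝ).hasFDerivAt.comp_hasDerivAt
    t h1
  exact h2

/-- The freedom in `L` lets truncations at different levels be written over one common index range.
-/
theorem hasSum_truncMat_row_of_le {N L : ℕ} (hL : N ≤ L) (m : ℕ → ℕ → ℂ) (u : ℕ → ℂ) (n : ℕ) :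
    HasSum (fun k => truncMat N m n k * u k)
      (∑ k ∈ Finset.range (L + 1), truncMat N m n k * u k) := by
  refine hasSum_sum_of_ne_finset_zero fun k hk => ?_
  rw [truncMat, if_neg fun h => hk (Finset.mem_range.2 (Nat.lt_succ_of_le (h.2.trans hL))),
    zero_mul]

theorem norm_truncMat_sub_le {N N' : ℕ} (hN : N ≤ N') (m : ℕ → ℕ → ℂ) (n k : ℕ) :
    ‖(truncMat N' m - truncMat N m) n k‖ ≤ ‖(m - truncMat N m) n k‖ := by
  simp only [Pi.sub_apply, truncMat]
  split_ifs with h1 h2 h2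
  · exact le_rfl
  · exact le_rfl
  · exact absurd ⟨h2.1.trans hN, h2.2.trans hN⟩ h1
  · simp

/-- A solution in `E_γ` of the system truncated at `N`. -/
def IsTruncSolution {γ : ℝ} (N : ℕ) (m : ℕ → ℕ → ℂ) (u : ℝ → E γ) : Prop :=
  ∀ C (hB : MatBound (truncMat N m) γ γ C), ∀ t, HasDerivAt u (hB.op (u t)) t

theorem exists_isTruncSolution {γ : ℝ} (N : ℕ) (m : ℕ → ℕ → ℂ) (x : E γ) :
    ∃ u : ℝ → E γ, u 0 = x ∧ IsTruncSolution N m u := by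
  obtain ⟨C, hB⟩ := exists_matBound_truncMat N m γ γ
  obtain ⟨u, hu0, hu⟩ := hB.exists_solution x
  -- The values of `op` depend only on the matrix, so one bound serves for all.
  exact ⟨u, hu0, fun _ _ t => hu t⟩

namespace IsTruncSolution

variable {γ : ℝ} {N : ℕ} {m : ℕ → ℕ → ℂ} {u : ℝ → E γ}

theorem continuous (hu : IsTruncSolution N m u) : Continuous u := by
  obtain ⟨C, hB⟩ := exists_matBound_truncMat N m γ γ
  exact continuous_iff_continuousAt.2 fun t => (hu C hB t).continuousAt

theorem coord_deriv (hu : IsTruncSolution N m u) {L : ℕ} (hL : N ≤ L) (n : ℕ) (t : ℝ) :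
    HasDerivAt (fun s => (u s).seq n)
      (∑ k ∈ Finset.range (L + 1), truncMat N m n k * (u t).seq k) t := by
  obtain ⟨C, hB⟩ := exists_matBound_truncMat N m γ γ
  have h1 := ((E.coordL γ n).restrictScalars ℝ).hasFDerivAt.comp_hasDerivAt t (hu C hB t)
  have h2 := (hB.hasSum_op (u t) n).unique (hasSum_truncMat_row_of_le hL m (u t).seq n)
  rw [← h2]
  exact h1

theorem isClassicalSolution (hu : IsTruncSolution N m u) {αs α' T : ℝ} (hγ : α' ≤ γ) :
    IsClassicalSolution αs α' T (truncMat N m) (u 0).seq fun t => E.incl hγ (u t) := by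
  obtain ⟨C, hB⟩ := exists_matBound_truncMat N m γ γ
  refine ⟨fun n => E.seq_incl hγ (u 0) n, ((E.inclL hγ).continuous.comp hu.continuous).continuousOn,
    fun α'' _ h => ?_⟩
  have hle := h.le.trans hγ
  refine ⟨fun t => E.incl hle (hB.op (u t)),
    ((E.inclL hle).continuous.comp (hB.op.continuous.comp hu.continuous)).continuousOn,
    fun t _ => ⟨?_, fun n => ?_⟩⟩
  · simp only [E.incl_incl]
    exact (((E.inclL hle).restrictScalars ℝ).hasFDerivAt.comp_hasDerivAt t
      (hu C hB t)).hasDerivWithinAt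
  · simp only [E.seq_incl]
    exact hB.hasSum_op (u t) n

end IsTruncSolution

/-! ### Convergence of the truncated solutions. -/

section Existence

variable {d : ℕ → ℝ} {e : ℕ → ℕ → ℂ} {lam K β₀ β₁ γ T : ℝ}

/-- The bound is uniform in `N`. It concerns partial sums because the exponent `β₁ - lam t` may
exceed `γ`, where `u` is known to live. -/
theorem ColBound.sum_truncSolution_le (h : ColBound d e lam K β₀ β₁) (hT : β₀ ≤ β₁ - lam * T)
    (x : E β₁) {N : ℕ} {u : ℝ → E γ} (hu : IsTruncSolution N (sysMat d e) u)
    (h₀ : (u 0).seq = x.seq) {t : ℝ} (ht : t ∈ Icc 0 T) (L : ℕ) :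
    ∑ n ∈ Finset.range L, ‖(u t).seq n‖ * Real.exp ((β₁ - lam * t) * n) ≤
      ‖x‖ * Real.exp (K * T) := by
  have hL : N ≤ max N L := le_max_left _ _
  have key := (h.trunc N).sum_le_gronwallBound (Finset.range (max N L + 1))
    (z := fun n t => (u t).seq n) (f := fun _ _ => 0) (t₀ := 0) (t₁ := T) (β₂ := β₁)
    (Φ := ‖x‖) (F := 0) le_rfl (by rwa [sub_zero])
    (fun n _ => ((E.coordL γ n).continuous.comp hu.continuous).continuousOn)
    (fun t _ n _ => ?_) (fun t _ => by simp) ?_ ht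
  · rw [gronwallBound_ε0, sub_zero] at key
    refine le_trans ?_ (key.trans ?_)
    · exact Finset.sum_le_sum_of_subset_of_nonneg
        (Finset.range_subset_range.2 ((le_max_right N L).trans (Nat.le_succ _)))
        fun n _ _ => by positivity
    · have := h.K_nonneg
      have := ht.2
      gcongr
  · rw [← truncMat_sysMat, add_zero]
    exact (hu.coord_deriv hL n t).hasDerivWithinAt
  · rw [h₀]
    exact E.sum_le_norm x _

/-- The difference solves the system truncated at `N'` with inhomogeneity `(A^{N'} - A^N) u^N`. It
is measured at the exponent `β₁ - 3ε - lam t`, so the loss `3ε` lands exactly where `u^N` is bounded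
uniformly. -/
theorem ColBound.exists_norm_sub_le (h : ColBound d e lam K β₀ β₁) {ε : ℝ} (hε : 0 < ε)
    (hγ : β₀ ≤ γ) (hT0 : 0 ≤ T) (hT : γ + 3 * ε ≤ β₁ - lam * T) (x : E β₁) {u : ℕ → ℝ → E γ}
    (hu : ∀ N, IsTruncSolution N (sysMat d e) (u N)) (h₀ : ∀ N, (u N 0).seq = x.seq) :
    ∃ C, ∀ N N', N ≤ N' → ∀ t ∈ Icc 0 T, ‖u N' t - u N t‖ ≤ C * Real.exp (-ε * N) := by
  obtain ⟨C, hC⟩ := h.exists_matBound_tail hε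
  set G := gronwallBound 0 K 1 T with hG
  refine ⟨C * (‖x‖ * Real.exp (K * T)) * G, fun N N' hN t ht => ?_⟩
  have hlam := h.lam_nonneg
  have hβ : ∀ t ∈ Icc 0 T, γ ≤ β₁ - 3 * ε - lam * t ∧ β₁ - 3 * ε - lam * t ≤ β₁ - 3 * ε := by
    intro t ht
    have h1 := mul_nonneg hlam ht.1
    have h2 := mul_le_mul_of_nonneg_left ht.2 hlam
    exact ⟨by linarith, by linarith⟩
  have hest : ∀ L, N' ≤ L → ∑ n ∈ Finset.range (L + 1),
      ‖(u N' t).seq n - (u N t).seq n‖ * Real.exp ((β₁ - 3 * ε - lam * (t - 0)) * n) ≤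
        gronwallBound 0 K (C * Real.exp (-ε * N) * (‖x‖ * Real.exp (K * T))) (t - 0) := by
    intro L hL
    refine (h.trunc N').sum_le_gronwallBound (Finset.range (L + 1))
      (z := fun n t => (u N' t).seq n - (u N t).seq n)
      (f := fun n t => ∑ k ∈ Finset.range (L + 1),
        (truncMat N' (sysMat d e) - truncMat N (sysMat d e)) n k * (u N t).seq k)
      (t₀ := 0) (t₁ := T) (by linarith) (by linarith) (fun n _ => ?_) (fun t ht n _ => ?_)
      (fun t ht => ?_) ?_ ht
    · exact (((E.coordL γ n).continuous.comp (hu N').continuous).sub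
        ((E.coordL γ n).continuous.comp (hu N).continuous)).continuousOn
    · rw [← truncMat_sysMat]
      refine (((hu N').coord_deriv hL n t).sub
        ((hu N).coord_deriv (hN.trans hL) n t)).hasDerivWithinAt.congr_deriv ?_
      rw [← Finset.sum_sub_distrib, ← Finset.sum_add_distrib]
      refine Finset.sum_congr rfl fun k _ => ?_
      simp only [Pi.sub_apply]
      ring
    · have ht' : t ∈ Icc 0 T := ⟨ht.1, ht.2.le⟩
      obtain ⟨h1, h2⟩ := hβ t ht'
      have hB := (hC N (β₁ - 3 * ε - lam * t) (by linarith) (by linarith)).mono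
        (norm_truncMat_sub_le hN (sysMat d e))
      rw [show β₁ - 3 * ε - lam * t + 3 * ε = β₁ - lam * t by ring] at hB
      have hb := h.sum_truncSolution_le (by linarith) x (hu N) (h₀ N) ht'
      set U : E (β₁ - lam * t) := E.mk (u N t).seq
        (summable_of_sum_range_le (fun n => by positivity) hb) with hU
      have hUn : ‖U‖ ≤ ‖x‖ * Real.exp (K * T) := E.norm_le_of_sum_le U fun L => by
        simpa only [hU, E.seq_mk] using hb L
      have hrow : ∀ n, (hB.op U).seq n = ∑ k ∈ Finset.range (L + 1),
          (truncMat N' (sysMat d e) - truncMat N (sysMat d e)) n k * (u N t).seq k := by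
        intro n
        refine (hB.hasSum_op U n).unique ?_
        simp only [hU, E.seq_mk]
        have := (hasSum_truncMat_row_of_le hL (sysMat d e) (u N t).seq n).sub
          (hasSum_truncMat_row_of_le (hN.trans hL) (sysMat d e) (u N t).seq n)
        rw [← Finset.sum_sub_distrib] at this
        simp only [Pi.sub_apply, sub_mul]
        exact this
      simp only [← hrow, sub_zero]
      exact (E.sum_le_norm (hB.op U) _).trans ((hB.norm_op_le U).trans
        (mul_le_mul_of_nonneg_left hUn hB.nonneg))
    · simp [h₀]
  refine E.norm_le_of_sum_le _ fun L => ?_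
  calc ∑ n ∈ Finset.range L, ‖(u N' t - u N t).seq n‖ * Real.exp (γ * n)
      ≤ ∑ n ∈ Finset.range L, ‖(u N' t).seq n - (u N t).seq n‖ *
          Real.exp ((β₁ - 3 * ε - lam * (t - 0)) * n) := by
        gcongr with n _
        · exact le_of_eq (by rw [E.seq_sub])
        · rw [sub_zero]
          exact (hβ t ht).1
    _ ≤ ∑ n ∈ Finset.range (max N' L + 1), ‖(u N' t).seq n - (u N t).seq n‖ *
          Real.exp ((β₁ - 3 * ε - lam * (t - 0)) * n) :=
        Finset.sum_le_sum_of_subset_of_nonneg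
          (Finset.range_subset_range.2 ((le_max_right N' L).trans (Nat.le_succ _)))
          fun n _ _ => by positivity
    _ ≤ _ := hest _ (le_max_left _ _)
    _ ≤ gronwallBound 0 K (C * Real.exp (-ε * N) * (‖x‖ * Real.exp (K * T))) T := by
        refine gronwallBound_mono le_rfl ?_ h.K_nonneg (by linarith [ht.2])
        exact mul_nonneg (hC N β₀ le_rfl (by nlinarith [mul_nonneg hlam hT0])).nonneg
          (by positivity)
    _ = _ := by
        rw [gronwallBound_zero_left]
        ring

/-- The solutions of the truncated systems converge, uniformly in time, to a classical solution. -/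
theorem ColBound.exists_limit {α' : ℝ} (h : ColBound d e lam K α' β₁) {ε : ℝ} (hε : 0 < ε)
    (hγ : γ = α' + 3 * ε) (hT0 : 0 ≤ T) (hT : γ + 3 * ε ≤ β₁ - lam * T) (x : E β₁)
    {u : ℕ → ℝ → E γ} (hu : ∀ N, IsTruncSolution N (sysMat d e) (u N))
    (h₀ : ∀ N, (u N 0).seq = x.seq) (hα' : α' ≤ γ) (αs : ℝ) :
    ∃ U : ℝ → E γ, TendstoUniformlyOn u U atTop (Ico 0 T) ∧
      IsClassicalSolution αs α' T (sysMat d e) x.seq fun t => E.incl hα' (U t) := by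
  have := E.completeSpace γ
  have hlam := h.lam_nonneg
  have hlamT := mul_nonneg hlam hT0
  obtain ⟨C, hC⟩ := h.exists_norm_sub_le hε hα' hT0 hT x hu h₀
  have hlim0 : Tendsto (fun N : ℕ => C * Real.exp (-ε * N)) atTop (𝓝 0) := by
    simpa using (tendsto_exp_neg_mul_nat hε).const_mul C
  -- The limit is needed as a total function; outside `[0, T]` its value is arbitrary.
  have hpt : ∀ t, ∃ y, t ∈ Icc 0 T → Tendsto (fun N => u N t) atTop (𝓝 y) := by
    intro t
    by_cases ht : t ∈ Icc 0 T
    · have hcs : CauchySeq fun N => u N t := by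
        refine cauchySeq_of_le_tendsto_0 (fun N : ℕ => 2 * (C * Real.exp (-ε * N)))
          (fun n k N hn hk => ?_) (by simpa using hlim0.const_mul 2)
        refine (dist_triangle_right _ _ (u N t)).trans ?_
        rw [dist_eq_norm, dist_eq_norm]
        linarith [hC N n hn t ht, hC N k hk t ht]
      obtain ⟨y, hy⟩ := cauchySeq_tendsto_of_complete hcs
      exact ⟨y, fun _ => hy⟩
    · exact ⟨0, fun hmem => absurd hmem ht⟩
  choose U hU using hpt
  have hrate : ∀ N, ∀ t ∈ Icc 0 T, ‖u N t - U t‖ ≤ C * Real.exp (-ε * N) := by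
    intro N t ht
    refine le_of_tendsto ((tendsto_const_nhds (x := u N t)).sub (hU t ht)).norm ?_
    filter_upwards [eventually_ge_atTop N] with N' hN'
    rw [norm_sub_rev]
    exact hC N N' hN' t ht
  have hunif : TendstoUniformlyOn u U atTop (Icc 0 T) := by
    rw [Metric.tendstoUniformlyOn_iff]
    intro η hη
    filter_upwards [hlim0.eventually_lt_const hη] with N hN t ht
    rw [dist_comm, dist_eq_norm]
    exact (hrate N t ht).trans_lt hN
  have hUc : ContinuousOn U (Icc 0 T) :=
    hunif.continuousOn (Frequently.of_forall fun N => (hu N).continuous.continuousOn)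
  obtain ⟨R, hR⟩ := isCompact_Icc.exists_bound_of_continuousOn hUc
  obtain ⟨C₁, hC₁⟩ := h.exists_matBound (by positivity : 0 < 3 * ε)
  obtain ⟨C₂, hC₂⟩ := h.exists_matBound_tail hε
  have hA := hC₁ α' le_rfl (by linarith)
  have htail := fun N => hC₂ N α' le_rfl (by linarith)
  rw [← hγ] at hA
  simp only [← hγ] at htail
  choose C₃ hC₃ using fun N => exists_matBound_truncMat N (sysMat d e) γ γ
  have hderiv : TendstoUniformlyOn (fun N t => E.incl hα' ((hC₃ N).op (u N t)))
      (fun t => hA.op (U t)) atTop (Icc 0 T) := by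
    have hlim : Tendsto (fun N : ℕ => C₁ * (C * Real.exp (-ε * N)) +
        C₂ * Real.exp (-ε * N) * (C * Real.exp (-ε * N) + R)) atTop (𝓝 0) := by
      have := (hlim0.const_mul C₁).add
        (((tendsto_exp_neg_mul_nat hε).const_mul C₂).mul (hlim0.add_const R))
      simpa using this
    rw [Metric.tendstoUniformlyOn_iff]
    intro η hη
    filter_upwards [hlim.eventually_lt_const hη] with N hN t ht
    refine lt_of_le_of_lt ?_ hN
    -- Written as `A U - A^N u^N = (A - A^N) u^N - A (u^N - U)`: the first term is small by the tail
    -- bound, the second by the convergence in `E γ`.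
    have hdec : hA.op (U t) - E.incl hα' ((hC₃ N).op (u N t)) =
        (htail N).op (u N t) - hA.op (u N t - U t) := by
      rw [map_sub]
      refine E.ext_seq fun n => ?_
      have h1 := ((htail N).hasSum_op (u N t) n).unique
        (((hA.hasSum_op (u N t) n).sub ((hC₃ N).hasSum_op (u N t) n)).congr_fun fun k => by
          simp only [Pi.sub_apply, sub_mul])
      simp only [E.seq_sub, E.seq_incl, h1]
      ring
    have hbd : ‖u N t‖ ≤ C * Real.exp (-ε * N) + R := by
      calc ‖u N t‖ = ‖(u N t - U t) + U t‖ := by rw [sub_add_cancel]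
        _ ≤ _ := norm_add_le _ _
        _ ≤ _ := add_le_add (hrate N t ht) (hR t ht)
    rw [dist_eq_norm, hdec, add_comm]
    refine (norm_sub_le _ _).trans (add_le_add ?_ ?_)
    · exact ((htail N).norm_op_le _).trans (mul_le_mul_of_nonneg_left hbd (htail N).nonneg)
    · exact (hA.norm_op_le _).trans (mul_le_mul_of_nonneg_left (hrate N t ht) hA.nonneg)
  have hAc : ContinuousOn (fun t => hA.op (U t)) (Icc 0 T) :=
    hA.op.continuous.comp_continuousOn hUc
  have hd : ∀ t ∈ Icc 0 T,
      HasDerivWithinAt (fun t => E.incl hα' (U t)) (hA.op (U t)) (Icc 0 T) t := by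
    intro t ht
    refine hasDerivWithinAt_of_tendstoUniformlyOn (convex_Icc 0 T)
      (fN := fun N t => E.incl hα' (u N t)) (fun N s _ => ?_) (fun s hs => ?_) hderiv hAc ht
    · exact (((E.inclL hα').restrictScalars ℝ).hasFDerivAt.comp_hasDerivAt s
        (hu N _ (hC₃ N) s)).hasDerivWithinAt
    · exact ((E.inclL hα').continuous.tendsto (U s)).comp (hU s hs)
  refine ⟨U, hunif.mono Ico_subset_Icc_self, fun n => ?_,
    (E.inclL hα').continuous.comp_continuousOn (hUc.mono Ico_subset_Icc_self),
    fun α'' _ hlt => ⟨fun t => E.incl hlt.le (hA.op (U t)),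
      (E.inclL hlt.le).continuous.comp_continuousOn (hAc.mono Ico_subset_Icc_self),
      fun t ht => ⟨?_, fun n => ?_⟩⟩⟩
  · have h0 : (0 : ℝ) ∈ Icc 0 T := ⟨le_rfl, hT0⟩
    have h1 := ((E.coordL γ n).continuous.tendsto (U 0)).comp (hU 0 h0)
    rw [E.seq_incl]
    refine tendsto_nhds_unique h1 (Tendsto.congr (fun N => ?_) tendsto_const_nhds)
    rw [Function.comp_apply, E.coordL_apply, h₀ N]
  · exact ((E.inclL hlt.le).restrictScalars ℝ).hasFDerivAt.comp_hasDerivWithinAt t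
      ((hd t (Ico_subset_Icc_self ht)).mono Ico_subset_Icc_self)
  · simp only [E.seq_incl]
    exact hA.hasSum_op (U t) n

end Existence

end InfODE

/-! ### Choice of the exponents. -/

theorem theorem4p2 (αs : ℝ) (M : ℝ → ℝ) (a : ℕ → ℕ → ℂ) (d : ℕ → ℝ) (b c : ℕ → ℕ → ℂ)
    (hE : InfODE.Conditions αs M a d b c) (α' α : ℝ) (hα' : αs < α') (hα : α' < α)
    (x : InfODE.E α) :
    ∃ (u : ℝ → InfODE.E α') (uN : ℕ → ℝ → InfODE.E α'),
      InfODE.IsUniqueClassicalSolution αs α' (InfODE.lifeTime M α' α) a x.seq u ∧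
      (∀ N : ℕ, 1 ≤ N →
        InfODE.IsUniqueClassicalSolution αs α' (InfODE.lifeTime M α' α)
          (InfODE.coeff (InfODE.truncSeq N d) (InfODE.truncMat N b) (InfODE.truncMat N c))
          x.seq (uN N)) ∧
      ∀ T ∈ Set.Ioo 0 (InfODE.lifeTime M α' α),
        TendstoUniformlyOn uN u Filter.atTop (Set.Icc 0 T) := by
  open InfODE in
  have hM : 0 < M α := hE.M_pos α (hα'.trans hα)
  obtain rfl : a = sysMat d fun n k => b n k + c n k := by
    rw [← coeff_eq_sysMat]
    funext n k
    exact hE.decomposition n k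
  rw [show InfODE.lifeTime M α' α = (α - α') / (2 * Real.exp 1 * M α) from rfl]
  set T := (α - α') / (2 * Real.exp 1 * M α) with hTdef
  have hT0 : 0 < T := div_pos (sub_pos.2 hα) (by positivity)
  have hlamT : Real.exp 1 * M α * T = (α - α') / 2 := by
    rw [hTdef]
    field_simp
  -- In units of `ε` the drift `lam T` is `12`. Starting at `β₁ = α - 3ε`, the exponent ends at `α'
  -- + 9ε`, above the required `γ + 3ε = α' + 6ε`.
  obtain ⟨ε, hε, hεα⟩ : ∃ ε > 0, 24 * ε = α - α' :=
    ⟨(α - α') / 24, by linarith, by ring⟩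
  have hβ₁ : α - 3 * ε < α := by linarith
  have h := hE.colBound hα' hβ₁ (hα'.trans hα)
  have hγα : α' + 3 * ε ≤ α := by linarith
  have hα'γ : α' ≤ α' + 3 * ε := by linarith
  choose u hu0 hu using fun N : ℕ => exists_isTruncSolution N
    (sysMat d fun n k => b n k + c n k) (E.incl hγα x)
  obtain ⟨U, hU, hsol⟩ := h.exists_limit hε rfl hT0.le (by linarith)
    (E.incl hβ₁.le x) hu (fun N => by rw [hu0 N]; funext n; simp only [E.seq_incl]) hα'γ αs
  rw [show (E.incl hβ₁.le x).seq = x.seq from funext (E.seq_incl hβ₁.le x)] at hsol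
  -- A competing solution is known only in `E α'`, so uniqueness uses a second column bound with
  -- exponents strictly between `αs` and `α'`.
  obtain ⟨η₀, hη₀, hη₀'⟩ := exists_between hα'
  obtain ⟨η₁, hη₁, hη₁'⟩ := exists_between hη₀'
  have huniq := hE.colBound hη₀ hη₁' hα'
  refine ⟨fun t => E.incl hα'γ (U t), fun N t => E.incl hα'γ (u N t),
    ⟨hsol, fun v hv => huniq.eqOn_of_isClassicalSolution hη₀ hη₁ hη₁' hsol hv⟩,
    fun N _ => ?_, fun T' hT' => ?_⟩
  · have hN : IsClassicalSolution αs α' T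
        (truncMat N (sysMat d fun n k => b n k + c n k)) x.seq
        fun t => E.incl hα'γ (u N t) := by
      have := (hu N).isClassicalSolution (αs := αs) (T := T) hα'γ
      rwa [hu0 N, show (E.incl hγα x).seq = x.seq from funext (E.seq_incl hγα x)] at this
    rw [coeff_trunc, coeff_eq_sysMat]
    refine ⟨hN, fun v hv => ?_⟩
    rw [truncMat_sysMat] at hN hv
    exact (huniq.trunc N).eqOn_of_isClassicalSolution hη₀ hη₁ hη₁' hN hv
  · exact ((E.inclL hα'γ).uniformContinuous.comp_tendstoUniformlyOn hU).mono
      fun t ht => ⟨ht.1, ht.2.trans_lt hT'.2⟩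

end
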